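/- For complex numbers $a,q$ and an integer $m\ge 0$ put $(a;q)_m=\prod_{j=0}^{m-1}(1-aq^j)$, and for $|q|<1$ put $(a;q)_\infty=\prod_{j=0}^{\infty}(1-aq^j)$ and $(a,b,c;q)_\infty=(a;q)_\infty(b;q)_\infty(c;q)_\infty$. Then for every complex $q$ with $|q|<1$ the following two double series converge absolutely and $$\sum_{n,r\ge 0}\frac{q^{3n^2+6nr+4r^2}\,(q;q)_{n+r}\,(q;q)_{2n+3r}\,(q;q)_{n+2r}}{(q^3;q^3)_{n+r}\,(q^3;q^3)_{n+2r}\,(q;q)_n\,(q;q)_r\,(q;q)_{2n+2r}}=\frac{(q^5,q^6,q^{11};q^{11})_\infty}{(q^3;q^3)_\infty},$$ $$\sum_{n,r\ge 0}\frac{q^{3n^2+6nr+4r^2+3n+4r}\,(q;q)_{n+r}\,(q;q)_{2n+3r+1}\,(q;q)_{n+2r+1}}{(q^3;q^3)_{n+r}\,(q^3;q^3)_{n+2r+1}\,(q;q)_n\,(q;q)_r\,(q;q)_{2n+2r+1}}=\frac{(q,q^{10},q^{11};q^{11})_\infty}{(q^3;q^3)_\infty}.$$ -/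

import Mathlib

/-- The finite rising `q`-factorial `(a; q)_m = ∏_{j=0}^{m-1} (1 - a q^j)`. -/
noncomputable def qFactorial (a q : ℂ) (m : ℕ) : ℂ :=
  ∏ j ∈ Finset.range m, (1 - a * q ^ j)

/-- The infinite rising `q`-factorial `(a; q)_∞ = ∏_{j=0}^∞ (1 - a q^j)`, for `|q| < 1`. -/
noncomputable def qFactorialInf (a q : ℂ) : ℂ :=
  ∏' j : ℕ, (1 - a * q ^ j)

/-- The abbreviation `(a, b, c; q)_∞ = (a; q)_∞ (b; q)_∞ (c; q)_∞`. -/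
noncomputable def qFactorialInf₃ (a b c q : ℂ) : ℂ :=
  qFactorialInf a q * qFactorialInf b q * qFactorialInf c q

/-- For `|q| < 1` the infinite product defining `(a; q)_∞` converges. -/
theorem multipliable_qFactorialInf (a : ℂ) {q : ℂ} (hq : ‖q‖ < 1) :
    Multipliable fun j : ℕ => 1 - a * q ^ j := by
  have h : Summable fun j : ℕ => ‖-(a * q ^ j)‖ := by
    simpa [norm_mul, norm_pow] using
      (summable_geometric_of_lt_one (norm_nonneg q) hq).mul_left ‖a‖
  simpa [sub_eq_add_neg] using multipliable_one_add_of_summable h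

open Finset Filter Topology

/-! Both identities are the cases `c = 0, 1` of one argument. Put N = n + r: the exponent becomes
3(N² + cN) + (r² + cr), so for fixed N there is a finite inner sum over r. The proof applies three
Bailey-type steps to the unit Bailey pair relative to q^c. The inner sum is rewritten by
`sum_transformation` with parameters involving a primitive cube root of unity, which produces
(q³;q³)-factorials because (1 - ωx)(1 - ω²x) = 1 + x + x². The new form (`sum_inner_eq`) contains
1/(q;q)_k, which is what the ordinary Bailey lemma makes of the unit pair (`IsUnitBailey.sum_eq`). A
change of base from q to q³ (`sum_cubic_kernel`) then gives a single sum over α_j with weight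
q^{2(j²+cj)} (`IsUnitBailey.sum_inner`). Summing over N against q^{3(N²+cN)} is a limiting Bailey
step in base q³; it contributes q^{3(j²+cj)}/(q³;q³)_∞. What remains is ∑ q^{5(j²+cj)} α_j, a theta
series in base q¹¹, evaluated by the Jacobi triple product. Both kernels and the transformation come
from the q-Pfaff–Saalschütz sum. -/

/-- The product `∏_{j<k} (A - q^j)`. -/
noncomputable def qShiftedProd (A q : ℂ) (k : ℕ) : ℂ :=
  ∏ j ∈ range k, (A - q ^ j)

theorem qFactorial_zero (a q : ℂ) : qFactorial a q 0 = 1 := by simp [qFactorial]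

theorem qFactorial_succ (a q : ℂ) (m : ℕ) :
    qFactorial a q (m + 1) = qFactorial a q m * (1 - a * q ^ m) := by
  simp [qFactorial, prod_range_succ]

theorem qFactorial_add (a q : ℂ) (m n : ℕ) :
    qFactorial a q (m + n) = qFactorial a q m * qFactorial (a * q ^ m) q n := by
  simp only [qFactorial, prod_range_add, pow_add, mul_assoc]

theorem qFactorial_succ' (a q : ℂ) (m : ℕ) :
    qFactorial a q (m + 1) = (1 - a) * qFactorial (a * q) q m := by
  rw [add_comm, qFactorial_add]
  simp [qFactorial]

theorem qShiftedProd_zero (a q : ℂ) : qShiftedProd a q 0 = 1 := by simp [qShiftedProd]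

theorem qShiftedProd_succ (a q : ℂ) (m : ℕ) :
    qShiftedProd a q (m + 1) = qShiftedProd a q m * (a - q ^ m) := by
  simp [qShiftedProd, prod_range_succ]

theorem one_sub_pow_ne_zero {q : ℂ} (hq : ‖q‖ < 1) (m : ℕ) : 1 - q ^ (m + 1) ≠ 0 := by
  intro h
  have h1 : ‖q ^ (m + 1)‖ < 1 := by
    rw [norm_pow]
    exact pow_lt_one₀ (norm_nonneg _) hq (by simp)
  rw [← sub_eq_zero.1 h] at h1
  simp at h1

theorem qFactorial_self_succ (q : ℂ) (m : ℕ) :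
    qFactorial q q (m + 1) = qFactorial q q m * (1 - q ^ (m + 1)) := by
  rw [qFactorial_succ, pow_succ']

theorem qFactorial_self_ne_zero {q : ℂ} (hq : ‖q‖ < 1) (m : ℕ) : qFactorial q q m ≠ 0 := by
  induction m with
  | zero => simp [qFactorial]
  | succ m ih =>
    rw [qFactorial_self_succ]
    exact mul_ne_zero ih (one_sub_pow_ne_zero hq m)

/-! ### The q-Pfaff–Saalschütz sum and its consequences. -/

/-- The summand of the `q`-Pfaff–Saalschütz sum. -/
noncomputable def saalschutzTerm (A B C q : ℂ) (n k : ℕ) : ℂ :=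
  qShiftedProd A q k * qShiftedProd B q k * C ^ k * qFactorial (C * A * B) q (n - k) *
    qFactorial (C * q ^ k) q (n - k) / (qFactorial q q k * qFactorial q q (n - k))

/-- Creative telescoping for the recurrence of the sum in n = m + i. The truncation at m of the
recurrence's defect has closed form; the induction advances m with n fixed, trading one unit of i.
The products ∏(A - q^j) replace A^k (1/A;q)_k, so A = 0 is allowed. -/
theorem sum_saalschutzTerm_telescope {q : ℂ} (hq : ‖q‖ < 1) (A B C : ℂ) (m i : ℕ) :
    ∑ k ∈ range (m + 1), ((1 - q ^ (m + i + 1)) * saalschutzTerm A B C q (m + i + 1) k -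
      (1 - C * A * q ^ (m + i)) * (1 - C * B * q ^ (m + i)) * saalschutzTerm A B C q (m + i) k) =
    -(q ^ i * qShiftedProd A q (m + 1) * qShiftedProd B q (m + 1) * C ^ (m + 1) *
      qFactorial (C * A * B) q i * qFactorial (C * q ^ m) q i /
        (qFactorial q q m * qFactorial q q i)) := by
  induction m generalizing i with
  | zero =>
    have h1 := qFactorial_self_ne_zero hq i
    have h2 := one_sub_pow_ne_zero hq i
    simp only [saalschutzTerm, zero_add, sum_range_one, qShiftedProd_succ, qShiftedProd_zero,
      qFactorial_zero, Nat.sub_zero, qFactorial_self_succ, pow_zero, mul_one, one_mul, pow_one]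
    rw [qFactorial_succ (C * A * B), qFactorial_succ C]
    field_simp
    ring
  | succ m ih =>
    have h1 := qFactorial_self_ne_zero hq i
    have h2 := one_sub_pow_ne_zero hq i
    have h3 := qFactorial_self_ne_zero hq m
    have h4 := one_sub_pow_ne_zero hq m
    have e : m + 1 + i = m + (i + 1) := by ring
    rw [sum_range_succ, e, ih (i + 1)]
    have e1 : m + (i + 1) + 1 - (m + 1) = i + 1 := by omega
    have e2 : m + (i + 1) - (m + 1) = i := by omega
    simp only [saalschutzTerm, e1, e2, qFactorial_self_succ]
    rw [qFactorial_succ' (C * q ^ m), qFactorial_succ (C * A * B), qFactorial_succ (C * q ^ (m + 1)),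
      qShiftedProd_succ A q (m + 1), qShiftedProd_succ B q (m + 1), mul_assoc C (q ^ m) q, ← pow_succ]
    field_simp
    ring

/-- The `q`-Pfaff–Saalschütz summation. -/
theorem sum_saalschutzTerm {q : ℂ} (hq : ‖q‖ < 1) (A B C : ℂ) (n : ℕ) :
    ∑ k ∈ range (n + 1), saalschutzTerm A B C q n k =
      qFactorial (C * A) q n * qFactorial (C * B) q n / qFactorial q q n := by
  induction n with
  | zero => simp [saalschutzTerm, qFactorial, qShiftedProd]
  | succ n ih =>
    -- At i = 0 the defect is exactly minus 1 - q^(n+1) times the term k = n + 1, which the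
    -- truncated sum leaves out.
    have h := sum_saalschutzTerm_telescope hq A B C n 0
    have h1 := qFactorial_self_ne_zero hq n
    have h2 := one_sub_pow_ne_zero hq n
    have h3 : saalschutzTerm A B C q (n + 1) (n + 1) = qShiftedProd A q (n + 1) *
        qShiftedProd B q (n + 1) * C ^ (n + 1) / (qFactorial q q n * (1 - q ^ (n + 1))) := by
      simp [saalschutzTerm, qFactorial_zero, qFactorial_self_succ]
    rw [sum_sub_distrib, ← mul_sum, ← mul_sum, add_zero, ih] at h
    rw [sum_range_succ, h3, qFactorial_self_succ, qFactorial_succ, qFactorial_succ]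
    simp only [qFactorial_zero, pow_zero, one_mul, mul_one] at h
    rw [sub_eq_iff_eq_add] at h
    apply mul_left_cancel₀ h2
    rw [mul_add, h]
    field_simp
    ring

theorem qShiftedProd_zero_sq (q : ℂ) (k : ℕ) :
    qShiftedProd 0 q k * qShiftedProd 0 q k = q ^ (k * (k - 1)) := by
  induction k with
  | zero => simp [qShiftedProd]
  | succ k ih =>
    have e : (k + 1) * (k + 1 - 1) = k * (k - 1) + 2 * k := by
      cases k with
      | zero => rfl
      | succ k => rw [Nat.add_sub_cancel, Nat.add_sub_cancel]; ring
    rw [qShiftedProd_succ, e, pow_add, ← ih]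
    ring

/-- The limiting case `A = B = 0` of `sum_saalschutzTerm`. -/
theorem sum_vandermonde {q : ℂ} (hq : ‖q‖ < 1) (C : ℂ) (n : ℕ) :
    ∑ k ∈ range (n + 1), q ^ (k * (k - 1)) * C ^ k * qFactorial (C * q ^ k) q (n - k) /
      (qFactorial q q k * qFactorial q q (n - k)) = 1 / qFactorial q q n := by
  have h := sum_saalschutzTerm hq 0 0 C n
  have h0 : ∀ m, qFactorial 0 q m = 1 := fun m => by simp [qFactorial]
  simpa [saalschutzTerm, qShiftedProd_zero_sq, h0] using h

/-- A terminating transformation between a `3φ2` and a `2φ2` series. -/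
theorem sum_transformation {q : ℂ} (hq : ‖q‖ < 1) (A B C : ℂ) (n : ℕ) :
    ∑ r ∈ range (n + 1), q ^ (r * (r - 1)) * C ^ r * qFactorial (C * A * B) q r *
        qFactorial (C * A * q ^ r) q (n - r) * qFactorial (C * B * q ^ r) q (n - r) /
        (qFactorial q q r * qFactorial q q (n - r)) =
      ∑ k ∈ range (n + 1), qShiftedProd A q k * qShiftedProd B q k * C ^ k *
        qFactorial (C * A * B) q (n - k) / (qFactorial q q k * qFactorial q q (n - k)) := by
  -- Expand the left side by Saalschütz with C replaced by C q^r, and the factor 1/(q;q)_{n-k} on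
  -- the right by its A = B = 0 case with C replaced by C q^k. The two double sums then agree term
  -- by term.
  have hl : ∀ r ∈ range (n + 1), q ^ (r * (r - 1)) * C ^ r * qFactorial (C * A * B) q r *
        qFactorial (C * A * q ^ r) q (n - r) * qFactorial (C * B * q ^ r) q (n - r) /
        (qFactorial q q r * qFactorial q q (n - r)) =
      ∑ k ∈ range (n - r + 1), q ^ (r * (r - 1)) * C ^ r * qFactorial (C * A * B) q r /
        qFactorial q q r * saalschutzTerm A B (C * q ^ r) q (n - r) k := by
    intro r _
    rw [← mul_sum, sum_saalschutzTerm hq, mul_right_comm C A, mul_right_comm C B]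
    ring_nf
  have hr : ∀ k ∈ range (n + 1), qShiftedProd A q k * qShiftedProd B q k * C ^ k *
        qFactorial (C * A * B) q (n - k) / (qFactorial q q k * qFactorial q q (n - k)) =
      ∑ r ∈ range (n - k + 1), qShiftedProd A q k * qShiftedProd B q k * C ^ k *
        qFactorial (C * A * B) q (n - k) / qFactorial q q k *
        (q ^ (r * (r - 1)) * (C * q ^ k) ^ r * qFactorial (C * q ^ k * q ^ r) q (n - k - r) /
          (qFactorial q q r * qFactorial q q (n - k - r))) := by
    intro k _
    rw [← mul_sum, sum_vandermonde hq]
    ring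
  rw [sum_congr rfl hl, sum_congr rfl hr]
  rw [sum_comm' (s' := fun k => range (n - k + 1)) (t' := range (n + 1))
    (by intro x y; simp only [mem_range]; omega)]
  refine sum_congr rfl fun k hk => sum_congr rfl fun r hr => ?_
  simp only [mem_range] at hk hr
  obtain ⟨i, rfl⟩ : ∃ i, n = r + k + i := ⟨n - (r + k), by omega⟩
  have e1 : r + k + i - r - k = i := by omega
  have e2 : r + k + i - k - r = i := by omega
  have e3 : r + k + i - r = k + i := by omega
  have e4 : r + k + i - k = r + i := by omega
  simp only [saalschutzTerm, e3, e4, Nat.add_sub_cancel_left, qFactorial_add (C * A * B) q r i]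
  rw [show C * q ^ r * A * B = C * A * B * q ^ r by ring,
    show C * q ^ k * q ^ r = C * q ^ r * q ^ k by ring]
  ring

/-! ### Cube roots of unity and factorials in base q³. -/

/-- The product `∏_{i=1}^m (1 + q^i + q^{2i})`, the quotient of `(q³; q³)_m` by `(q; q)_m`. -/
noncomputable def cubicProd (q : ℂ) (m : ℕ) : ℂ :=
  ∏ i ∈ range m, (1 + q ^ (i + 1) + q ^ (2 * (i + 1)))

theorem cubicProd_succ (q : ℂ) (m : ℕ) :
    cubicProd q (m + 1) = cubicProd q m * (1 + q ^ (m + 1) + q ^ (2 * (m + 1))) := by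
  simp [cubicProd, prod_range_succ]

theorem qFactorial_cube (q : ℂ) (m : ℕ) :
    qFactorial (q ^ 3) (q ^ 3) m = qFactorial q q m * cubicProd q m := by
  simp only [qFactorial, cubicProd, ← prod_mul_distrib]
  refine prod_congr rfl fun i _ => ?_
  ring

theorem norm_cube_lt_one {q : ℂ} (hq : ‖q‖ < 1) : ‖q ^ 3‖ < 1 := by
  rw [norm_pow]
  exact pow_lt_one₀ (norm_nonneg _) hq (by simp)

theorem cubicProd_ne_zero {q : ℂ} (hq : ‖q‖ < 1) (m : ℕ) : cubicProd q m ≠ 0 := by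
  have h := qFactorial_self_ne_zero (norm_cube_lt_one hq) m
  rw [qFactorial_cube] at h
  exact right_ne_zero_of_mul h

theorem exists_primitive_cube_root : ∃ w : ℂ, w ^ 2 + w + 1 = 0 := by
  have h : (Complex.exp (2 * Real.pi * Complex.I / (3 : ℕ))) ^ 3 = 1 :=
    (Complex.isPrimitiveRoot_exp 3 (by norm_num)).pow_eq_one
  have h1 : Complex.exp (2 * Real.pi * Complex.I / (3 : ℕ)) ≠ 1 :=
    (Complex.isPrimitiveRoot_exp 3 (by norm_num)).ne_one (by norm_num)
  refine ⟨Complex.exp (2 * Real.pi * Complex.I / (3 : ℕ)),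
    mul_left_cancel₀ (sub_ne_zero.2 h1) ?_⟩
  linear_combination h

/-- With N = i + k, each pair of factors is (ω²q^N - q^j)(ωq^N - q^j) = q^{2j}(1 + q^{N-j} +
q^{2(N-j)}). Multiplying by `cubicProd q i` avoids a quotient. -/
theorem qShiftedProd_mul_cubicProd {w : ℂ} (hw : w ^ 2 + w + 1 = 0) (q : ℂ) (i k : ℕ) :
    qShiftedProd (w ^ 2 * q ^ (i + k)) q k * qShiftedProd (w * q ^ (i + k)) q k * cubicProd q i =
      q ^ (k * (k - 1)) * cubicProd q (i + k) := by
  suffices h : ∀ N i, i + k = N →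
      qShiftedProd (w ^ 2 * q ^ N) q k * qShiftedProd (w * q ^ N) q k * cubicProd q i =
        q ^ (k * (k - 1)) * cubicProd q N from h _ i rfl
  intro N
  induction k with
  | zero => rintro i rfl; simp [qShiftedProd]
  | succ k ih =>
    intro i hi
    have e : (k + 1) * (k + 1 - 1) = k * (k - 1) + 2 * k := by
      cases k with
      | zero => rfl
      | succ k => rw [Nat.add_sub_cancel, Nat.add_sub_cancel]; ring
    have h := ih (i + 1) (by omega)
    have h1 : (w ^ 2 * q ^ N - q ^ k) * (w * q ^ N - q ^ k) =
        q ^ (2 * k) * (1 + q ^ (i + 1) + q ^ (2 * (i + 1))) := by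
      rw [← hi]
      linear_combination ((w - 1) * q ^ (2 * (i + (k + 1))) - q ^ (i + (k + 1)) * q ^ k) * hw
    rw [cubicProd_succ] at h
    rw [e, pow_add, qShiftedProd_succ, qShiftedProd_succ]
    linear_combination q ^ (2 * k) * h + qShiftedProd (w ^ 2 * q ^ N) q k * qShiftedProd (w * q ^ N) q k *
      cubicProd q i * h1

theorem qFactorial_mul_cubicProd {w : ℂ} (hw : w ^ 2 + w + 1 = 0) (q : ℂ) (m n : ℕ) :
    qFactorial (w ^ 2 * q ^ (m + 1)) q n * qFactorial (w * q ^ (m + 1)) q n * cubicProd q m =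
      cubicProd q (m + n) := by
  induction n with
  | zero => simp [qFactorial]
  | succ n ih =>
    rw [← add_assoc, cubicProd_succ, ← ih, qFactorial_succ, qFactorial_succ]
    linear_combination qFactorial (w ^ 2 * q ^ (m + 1)) q n * qFactorial (w * q ^ (m + 1)) q n *
      cubicProd q m * ((w - 1) * q ^ (2 * (m + 1 + n)) - q ^ (m + 1 + n)) * hw

theorem qFactorial_pow_succ_eq_div {q : ℂ} (hq : ‖q‖ < 1) (m n : ℕ) :
    qFactorial (q ^ (m + 1)) q n = qFactorial q q (m + n) / qFactorial q q m := by
  rw [qFactorial_add, ← pow_succ', mul_div_cancel_left₀ _ (qFactorial_self_ne_zero hq m)]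

/-! ### Kernels for the Bailey steps. -/

/-- The kernel of the Bailey lemma in the limit of infinite parameters. -/
theorem sum_bailey_kernel {q : ℂ} (hq : ‖q‖ < 1) (M c : ℕ) :
    ∑ s ∈ range (M + 1), q ^ (s ^ 2 + c * s) /
      (qFactorial q q (M - s) * qFactorial q q s * qFactorial q q (s + c)) =
      1 / (qFactorial q q M * qFactorial q q (M + c)) := by
  have h := sum_vandermonde hq (q ^ (c + 1)) M
  have hne := qFactorial_self_ne_zero hq
  rw [← div_div, ← h, sum_div]
  refine sum_congr rfl fun s hs => ?_
  have hs' : s ≤ M := by simpa [Nat.lt_succ_iff] using hs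
  obtain ⟨i, rfl⟩ := Nat.exists_eq_add_of_le' hs'
  have e : s ^ 2 + c * s = s * (s - 1) + (c + 1) * s := by
    cases s with
    | zero => rfl
    | succ s => rw [Nat.add_sub_cancel]; ring
  rw [← pow_add, show c + 1 + s = s + c + 1 by ring, qFactorial_pow_succ_eq_div hq,
    Nat.add_sub_cancel, show s + c + i = i + s + c by ring, e, pow_add, pow_mul q (c + 1)]
  have h1 := hne i
  have h2 := hne s
  have h3 := hne (s + c)
  have h4 := hne (i + s + c)
  field_simp

/-- The kernel of the cubic change of base in Bailey pairs. -/
theorem sum_cubic_kernel {q : ℂ} (hq : ‖q‖ < 1) (M c : ℕ) :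
    ∑ s ∈ range (M + 1), q ^ (s ^ 2 + c * s) * qFactorial q q (3 * M + c - s) /
      (qFactorial (q ^ 3) (q ^ 3) (M - s) * qFactorial q q s * qFactorial q q (s + c)) =
      qFactorial (q ^ 3) (q ^ 3) (2 * M + c) /
        (qFactorial (q ^ 3) (q ^ 3) M * qFactorial (q ^ 3) (q ^ 3) (M + c)) := by
  obtain ⟨w, hw⟩ := exists_primitive_cube_root
  have hne := qFactorial_self_ne_zero hq
  have hg := cubicProd_ne_zero hq
  -- Since ω³ = 1, this choice makes CAB = q^{2M+c+1} a pure power of q, while the factors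
  -- containing ω pair up into cubic products.
  have h := sum_saalschutzTerm hq (w ^ 2 * q ^ M) (w * q ^ M) (q ^ (c + 1)) M
  have hp := qFactorial_mul_cubicProd hw q (M + c) M
  rw [show q ^ (c + 1) * (w ^ 2 * q ^ M) = w ^ 2 * q ^ (M + c + 1) by ring,
    show q ^ (c + 1) * (w * q ^ M) = w * q ^ (M + c + 1) by ring, eq_div_of_mul_eq (hg _) hp,
    show M + c + M = 2 * M + c by ring] at h
  have hr : qFactorial (q ^ 3) (q ^ 3) (2 * M + c) /
        (qFactorial (q ^ 3) (q ^ 3) M * qFactorial (q ^ 3) (q ^ 3) (M + c)) =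
      cubicProd q (2 * M + c) / cubicProd q (M + c) / qFactorial q q M *
        (qFactorial q q (2 * M + c) / (qFactorial q q (M + c) * cubicProd q M)) := by
    simp only [qFactorial_cube]
    have h1 := hne M
    have h2 := hne (M + c)
    have h3 := hg M
    have h4 := hg (M + c)
    field_simp
  rw [hr, ← h, sum_mul]
  refine sum_congr rfl fun s hs => ?_
  have hs' : s ≤ M := by simpa [Nat.lt_succ_iff] using hs
  obtain ⟨i, rfl⟩ := Nat.exists_eq_add_of_le' hs'
  have e : s ^ 2 + c * s = s * (s - 1) + (c + 1) * s := by
    cases s with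
    | zero => rfl
    | succ s => rw [Nat.add_sub_cancel]; ring
  have hw3 : w ^ 3 = 1 := by linear_combination (w - 1) * hw
  have e1 : q ^ (c + 1) * (w ^ 2 * q ^ (i + s)) * (w * q ^ (i + s)) =
      q ^ (2 * (i + s) + c + 1) := by
    linear_combination q ^ (2 * (i + s) + c + 1) * hw3
  have e2 : 3 * (i + s) + c - s = 2 * (i + s) + c + i := by omega
  rw [saalschutzTerm, e1, ← pow_add q (c + 1) s, show c + 1 + s = s + c + 1 by ring,
    qFactorial_pow_succ_eq_div hq, qFactorial_pow_succ_eq_div hq, Nat.add_sub_cancel, e2,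
    eq_div_of_mul_eq (hg _) (qShiftedProd_mul_cubicProd hw q i s),
    show s + c + i = i + s + c by ring, qFactorial_cube, e, pow_add, pow_mul q (c + 1)]
  have h1 := hne i
  have h2 := hne s
  have h3 := hne (s + c)
  have h4 := hne (i + s + c)
  have h5 := hne (2 * (i + s) + c)
  have h6 := hg i
  have h7 := hg (i + s)
  field_simp

/-- The two forms of the inner sum: the first comes from the double series, the second from the
cubic change of base. -/
theorem sum_inner_eq {q : ℂ} (hq : ‖q‖ < 1) (N c : ℕ) :
    ∑ r ∈ range (N + 1), q ^ (r ^ 2 + c * r) * qFactorial q q N * qFactorial q q (2 * N + r + c) *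
        qFactorial q q (N + r + c) / (qFactorial (q ^ 3) (q ^ 3) N *
        qFactorial (q ^ 3) (q ^ 3) (N + r + c) * qFactorial q q (N - r) * qFactorial q q r *
        qFactorial q q (2 * N + c)) =
      (∑ k ∈ range (N + 1), q ^ (k ^ 2 + c * k) * qFactorial q q (3 * N + c - k) /
        (qFactorial (q ^ 3) (q ^ 3) (N - k) * qFactorial q q k)) /
        qFactorial (q ^ 3) (q ^ 3) (2 * N + c) := by
  obtain ⟨w, hw⟩ := exists_primitive_cube_root
  have hne := qFactorial_self_ne_zero hq
  have hg := cubicProd_ne_zero hq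
  -- The same specialisation as in the cubic kernel, with N for M.
  have h := sum_transformation hq (w ^ 2 * q ^ N) (w * q ^ N) (q ^ (c + 1)) N
  have hw3 : w ^ 3 = 1 := by linear_combination (w - 1) * hw
  have e1 : q ^ (c + 1) * (w ^ 2 * q ^ N) * (w * q ^ N) = q ^ (2 * N + c + 1) := by
    linear_combination q ^ (2 * N + c + 1) * hw3
  have e (s : ℕ) : s ^ 2 + c * s = s * (s - 1) + (c + 1) * s := by
    cases s with
    | zero => rfl
    | succ s => rw [Nat.add_sub_cancel]; ring
  rw [e1] at h
  have hl : ∀ r ∈ range (N + 1), q ^ (r ^ 2 + c * r) * qFactorial q q N *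
        qFactorial q q (2 * N + r + c) *
        qFactorial q q (N + r + c) / (qFactorial (q ^ 3) (q ^ 3) N *
        qFactorial (q ^ 3) (q ^ 3) (N + r + c) * qFactorial q q (N - r) * qFactorial q q r *
        qFactorial q q (2 * N + c)) = 1 / (cubicProd q N * cubicProd q (2 * N + c)) *
        (q ^ (r * (r - 1)) * (q ^ (c + 1)) ^ r * qFactorial (q ^ (2 * N + c + 1)) q r *
        qFactorial (q ^ (c + 1) * (w ^ 2 * q ^ N) * q ^ r) q (N - r) *
        qFactorial (q ^ (c + 1) * (w * q ^ N) * q ^ r) q (N - r) /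
        (qFactorial q q r * qFactorial q q (N - r))) := by
    intro s hs
    have hs' : s ≤ N := by simpa [Nat.lt_succ_iff] using hs
    obtain ⟨i, rfl⟩ := Nat.exists_eq_add_of_le' hs'
    have hp := qFactorial_mul_cubicProd hw q (i + s + s + c) i
    rw [show q ^ (c + 1) * (w ^ 2 * q ^ (i + s)) * q ^ s = w ^ 2 * q ^ (i + s + s + c + 1) by ring,
      show q ^ (c + 1) * (w * q ^ (i + s)) * q ^ s = w * q ^ (i + s + s + c + 1) by ring,
      Nat.add_sub_cancel, mul_assoc _ (qFactorial (w ^ 2 * _) q i), eq_div_of_mul_eq (hg _) hp,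
      show i + s + s + c + i = 2 * (i + s) + c by ring, qFactorial_pow_succ_eq_div hq,
      show 2 * (i + s) + s + c = 2 * (i + s) + c + s by ring, e, pow_add, pow_mul q (c + 1),
      qFactorial_cube, qFactorial_cube]
    have h1 := hne i
    have h2 := hne s
    have h3 := hne (i + s)
    have h4 := hne (i + s + s + c)
    have h5 := hne (2 * (i + s) + c)
    have h6 := hg (i + s)
    have h7 := hg (i + s + s + c)
    have h8 := hg (2 * (i + s) + c)
    field_simp
  rw [sum_congr rfl hl, ← mul_sum, h, mul_sum, sum_div]
  refine sum_congr rfl fun s hs => ?_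
  have hs' : s ≤ N := by simpa [Nat.lt_succ_iff] using hs
  obtain ⟨i, rfl⟩ := Nat.exists_eq_add_of_le' hs'
  rw [eq_div_of_mul_eq (hg _) (qShiftedProd_mul_cubicProd hw q i s), Nat.add_sub_cancel,
    qFactorial_pow_succ_eq_div hq, show 3 * (i + s) + c - s = 2 * (i + s) + c + i by omega,
    e, pow_add q (s * (s - 1)), pow_mul q (c + 1), qFactorial_cube, qFactorial_cube]
  have h1 := hne i
  have h2 := hne s
  have h5 := hne (2 * (i + s) + c)
  have h6 := hg (i + s)
  have h7 := hg i
  have h8 := hg (2 * (i + s) + c)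
  field_simp

/-! ### Unit Bailey pairs and the two Bailey steps. -/

theorem sum_range_triangle (f : ℕ → ℕ → ℂ) (n : ℕ) :
    ∑ r ∈ range (n + 1), ∑ j ∈ range (r + 1), f r j =
      ∑ j ∈ range (n + 1), ∑ s ∈ range (n - j + 1), f (j + s) j := by
  rw [sum_comm' (s' := fun j => Ico j (n + 1)) (t' := range (n + 1))
    (by intro x y; simp only [mem_range, mem_Ico]; omega)]
  refine sum_congr rfl fun j hj => ?_
  rw [mem_range] at hj
  rw [sum_Ico_eq_sum_range, show n + 1 - j = n - j + 1 by omega]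

/-- `α` is the first member of the unit Bailey pair relative to `q ^ c`. -/
def IsUnitBailey (q : ℂ) (c : ℕ) (α : ℕ → ℂ) : Prop :=
  ∀ r, ∑ j ∈ range (r + 1), α j / (qFactorial q q (r - j) * qFactorial q q (r + j + c)) =
    if r = 0 then 1 else 0

/-- One step of the Bailey lemma: ∑_r q^{r²+cr} β_r/(q;q)_{n-r} with β_r = δ_{r,0} collapses to
1/(q;q)_n. Interchanging sums applies the kernel to each α_j. -/
theorem IsUnitBailey.sum_eq {q : ℂ} (hq : ‖q‖ < 1) {c : ℕ} {α : ℕ → ℂ} (hα : IsUnitBailey q c α)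
    (n : ℕ) :
    ∑ j ∈ range (n + 1), q ^ (j ^ 2 + c * j) * α j /
      (qFactorial q q (n - j) * qFactorial q q (n + j + c)) = 1 / qFactorial q q n := by
  have h : ∑ r ∈ range (n + 1), ∑ j ∈ range (r + 1), q ^ (r ^ 2 + c * r) / qFactorial q q (n - r) *
      (α j / (qFactorial q q (r - j) * qFactorial q q (r + j + c))) = 1 / qFactorial q q n := by
    simp only [← mul_sum, hα _]
    simp
  rw [← h, sum_range_triangle]
  refine sum_congr rfl fun j hj => ?_
  have hj' : j ≤ n := by simpa [Nat.lt_succ_iff] using hj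
  obtain ⟨M, rfl⟩ := Nat.exists_eq_add_of_le' hj'
  -- For r = j + s, r² + cr = (j² + cj) + (s² + (2j + c)s), so the shift c becomes 2j + c.
  have hk := sum_bailey_kernel hq M (2 * j + c)
  rw [Nat.add_sub_cancel, show M + j + j + c = M + (2 * j + c) by ring, mul_div_assoc,
    ← mul_one (α j), mul_div_assoc (α j), ← hk, mul_sum, mul_sum]
  refine sum_congr rfl fun s hs => ?_
  rw [show M + j - (j + s) = M - s by omega, Nat.add_sub_cancel_left,
    show j + s + j + c = s + (2 * j + c) by ring]
  ring

/-- The second Bailey step, which changes base to q³: insert `IsUnitBailey.sum_eq` for 1/(q;q)_k in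
`sum_inner_eq` and sum over k by the cubic kernel. Each step contributes one factor q^{j²+cj}. -/
theorem IsUnitBailey.sum_inner {q : ℂ} (hq : ‖q‖ < 1) {c : ℕ} {α : ℕ → ℂ}
    (hα : IsUnitBailey q c α) (N : ℕ) :
    ∑ r ∈ range (N + 1), q ^ (r ^ 2 + c * r) * qFactorial q q N * qFactorial q q (2 * N + r + c) *
        qFactorial q q (N + r + c) / (qFactorial (q ^ 3) (q ^ 3) N *
        qFactorial (q ^ 3) (q ^ 3) (N + r + c) * qFactorial q q (N - r) * qFactorial q q r *
        qFactorial q q (2 * N + c)) =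
      ∑ j ∈ range (N + 1), q ^ (2 * (j ^ 2 + c * j)) * α j /
        (qFactorial (q ^ 3) (q ^ 3) (N - j) * qFactorial (q ^ 3) (q ^ 3) (N + j + c)) := by
  have h : ∀ k ∈ range (N + 1), q ^ (k ^ 2 + c * k) * qFactorial q q (3 * N + c - k) /
        (qFactorial (q ^ 3) (q ^ 3) (N - k) * qFactorial q q k) =
      ∑ j ∈ range (k + 1), q ^ (k ^ 2 + c * k) * qFactorial q q (3 * N + c - k) /
        qFactorial (q ^ 3) (q ^ 3) (N - k) * (q ^ (j ^ 2 + c * j) * α j /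
      (qFactorial q q (k - j) * qFactorial q q (k + j + c))) := by
    intro k _
    rw [← mul_sum, hα.sum_eq hq]
    ring
  rw [sum_inner_eq hq, sum_congr rfl h, sum_range_triangle, sum_div]
  refine sum_congr rfl fun j hj => ?_
  have hj' : j ≤ N := by simpa [Nat.lt_succ_iff] using hj
  obtain ⟨M, rfl⟩ := Nat.exists_eq_add_of_le' hj'
  have hk := sum_cubic_kernel hq M (2 * j + c)
  have h0 := qFactorial_self_ne_zero (norm_cube_lt_one hq) (2 * M + (2 * j + c))
  have hr : 1 / (qFactorial (q ^ 3) (q ^ 3) M * qFactorial (q ^ 3) (q ^ 3) (M + (2 * j + c))) =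
      (∑ s ∈ range (M + 1), q ^ (s ^ 2 + (2 * j + c) * s) *
        qFactorial q q (3 * M + (2 * j + c) - s) / (qFactorial (q ^ 3) (q ^ 3) (M - s) *
        qFactorial q q s * qFactorial q q (s + (2 * j + c)))) /
        qFactorial (q ^ 3) (q ^ 3) (2 * M + (2 * j + c)) := by
    rw [hk]
    field_simp
  rw [Nat.add_sub_cancel, show M + j + j + c = M + (2 * j + c) by ring,
    show 2 * (M + j) + c = 2 * M + (2 * j + c) by ring, div_eq_mul_one_div _ (_ * _), hr,
    ← mul_div_assoc, mul_sum]
  congr 1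
  refine sum_congr rfl fun s hs => ?_
  rw [mem_range] at hs
  rw [show M + j - (j + s) = M - s by omega, Nat.add_sub_cancel_left,
    show j + s + j + c = s + (2 * j + c) by ring,
    show 3 * (M + j) + c - (j + s) = 3 * M + (2 * j + c) - s by omega]
  ring

theorem choose_two_succ (j : ℕ) : (j + 1).choose 2 = j + j.choose 2 := by
  rw [Nat.choose_succ_succ' j 1, Nat.choose_one_right]

/-- The first member of the unit Bailey pair relative to `1`. -/
noncomputable def unitAlphaOne (q : ℂ) (j : ℕ) : ℂ :=
  if j = 0 then 1 else (-1) ^ j * q ^ j.choose 2 * (1 + q ^ j)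

/-- The first member of the unit Bailey pair relative to `q`. -/
noncomputable def unitAlphaBase (q : ℂ) (j : ℕ) : ℂ :=
  (-1) ^ j * q ^ j.choose 2 * (1 - q ^ (2 * j + 1))

theorem isUnitBailey_unitAlphaOne {q : ℂ} (hq : ‖q‖ < 1) : IsUnitBailey q 0 (unitAlphaOne q) := by
  have hne := qFactorial_self_ne_zero hq
  have hone := one_sub_pow_ne_zero hq
  -- For r = m + 1 + i the sum truncated at j = m has a product form, proved by moving m with r
  -- fixed. At i = 0 only the term j = r is missing, and it cancels the truncated sum.
  have key : ∀ m i, ∑ j ∈ range (m + 1), unitAlphaOne q j /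
      (qFactorial q q (m + 1 + i - j) * qFactorial q q (m + 1 + i + j)) =
      (-1) ^ m * q ^ (m + 1).choose 2 / (qFactorial q q i * qFactorial q q (m + 1 + i + m) *
        (1 - q ^ (m + i + 1))) := by
    intro m
    induction m with
    | zero =>
      intro i
      have h1 := hne i
      have h2 := hone i
      rw [zero_add, sum_range_one, zero_add, add_zero, Nat.sub_zero, add_comm 1 i,
        qFactorial_self_succ]
      simp [unitAlphaOne]
      field_simp
    | succ m ih =>
      intro i
      rw [sum_range_succ, show m + 1 + 1 + i = m + 1 + (i + 1) by ring, ih (i + 1),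
        show m + 1 + (i + 1) - (m + 1) = i + 1 by omega,
        show m + 1 + (i + 1) + (m + 1) = m + 1 + (i + 1) + m + 1 by ring,
        qFactorial_self_succ, qFactorial_self_succ, choose_two_succ (m + 1), unitAlphaOne,
        if_neg (Nat.succ_ne_zero m)]
      have h1 := hne i
      have h2 := hone i
      have h3 := hne (m + 1 + (i + 1) + m)
      have h4 := hone (m + 1 + (i + 1) + m)
      have h5 := hone (m + (i + 1))
      rw [show m + 1 + i + 1 = m + (i + 1) + 1 by ring]
      field_simp
      ring
  intro r
  cases r with
  | zero => simp [unitAlphaOne, qFactorial]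
  | succ m =>
    have h := key m 0
    have h3 := hne (m + 1 + m)
    have h4 := hone (m + 1 + m)
    have h5 := hone m
    rw [add_zero] at h
    simp only [add_zero]
    rw [sum_range_succ, h, Nat.sub_self, show m + 1 + (m + 1) = m + 1 + m + 1 by ring,
      qFactorial_self_succ, unitAlphaOne, if_neg (Nat.succ_ne_zero m), if_neg (Nat.succ_ne_zero m),
      qFactorial_zero]
    field_simp
    ring

theorem isUnitBailey_unitAlphaBase {q : ℂ} (hq : ‖q‖ < 1) :
    IsUnitBailey q 1 (unitAlphaBase q) := by
  have hne := qFactorial_self_ne_zero hq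
  have hone := one_sub_pow_ne_zero hq
  have key : ∀ m i, ∑ j ∈ range (m + 1), unitAlphaBase q j /
      (qFactorial q q (m + 1 + i - j) * qFactorial q q (m + 1 + i + j + 1)) =
      (-1) ^ m * q ^ (m + 1).choose 2 * (1 - q ^ (m + 1)) / (qFactorial q q i *
        qFactorial q q (m + 1 + i + m + 1) * (1 - q ^ (m + i + 1))) := by
    intro m
    induction m with
    | zero =>
      intro i
      have h1 := hne i
      have h2 := hone i
      rw [zero_add, sum_range_one, zero_add, add_zero, Nat.sub_zero, add_comm 1 i,
        qFactorial_self_succ q i]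
      simp [unitAlphaBase]
      field_simp
    | succ m ih =>
      intro i
      rw [sum_range_succ, show m + 1 + 1 + i = m + 1 + (i + 1) by ring, ih (i + 1),
        show m + 1 + (i + 1) - (m + 1) = i + 1 by omega,
        show m + 1 + (i + 1) + (m + 1) + 1 = m + 1 + (i + 1) + m + 1 + 1 by ring,
        qFactorial_self_succ q i, qFactorial_self_succ q (m + 1 + (i + 1) + m + 1),
        choose_two_succ (m + 1), unitAlphaBase]
      have h1 := hne i
      have h2 := hone i
      have h3 := hne (m + 1 + (i + 1) + m + 1)
      have h4 := hone (m + 1 + (i + 1) + m + 1)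
      have h5 := hone (m + (i + 1))
      rw [show m + 1 + i + 1 = m + (i + 1) + 1 by ring]
      field_simp
      ring
  intro r
  cases r with
  | zero =>
    have h := hone 0
    simp only [zero_add, pow_one] at h
    simp [unitAlphaBase, qFactorial, h]
  | succ m =>
    have h := key m 0
    have h3 := hne (m + 1 + m + 1)
    have h4 := hone (m + 1 + m + 1)
    have h5 := hone m
    rw [add_zero] at h
    rw [sum_range_succ, h, Nat.sub_self, show m + 1 + (m + 1) + 1 = m + 1 + m + 1 + 1 by ring,
      qFactorial_self_succ q (m + 1 + m + 1), unitAlphaBase, if_neg (Nat.succ_ne_zero m),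
      qFactorial_zero]
    field_simp
    ring

/-! ### Bounds and limits for dominated convergence. -/

theorem norm_unitAlphaOne_le {q : ℂ} (hq : ‖q‖ < 1) (j : ℕ) : ‖unitAlphaOne q j‖ ≤ 2 := by
  have hp (n : ℕ) : ‖q‖ ^ n ≤ 1 := pow_le_one₀ (norm_nonneg _) hq.le
  unfold unitAlphaOne
  split_ifs with h
  · simp
  · have h1 : ‖1 + q ^ j‖ ≤ 2 := (norm_add_le _ _).trans (by
      rw [norm_one, norm_pow]; linarith [hp j])
    rw [norm_mul, norm_mul, norm_pow, norm_neg, norm_one, one_pow, one_mul, norm_pow]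
    exact (mul_le_of_le_one_left (norm_nonneg _) (hp _)).trans h1

theorem norm_unitAlphaBase_le {q : ℂ} (hq : ‖q‖ < 1) (j : ℕ) : ‖unitAlphaBase q j‖ ≤ 2 := by
  have hp (n : ℕ) : ‖q‖ ^ n ≤ 1 := pow_le_one₀ (norm_nonneg _) hq.le
  have h1 : ‖1 - q ^ (2 * j + 1)‖ ≤ 2 := (norm_sub_le _ _).trans (by
    rw [norm_one, norm_pow]; linarith [hp (2 * j + 1)])
  unfold unitAlphaBase
  rw [norm_mul, norm_mul, norm_pow, norm_neg, norm_one, one_pow, one_mul, norm_pow]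
  exact (mul_le_of_le_one_left (norm_nonneg _) (hp _)).trans h1

theorem tendsto_qFactorial (a : ℂ) {q : ℂ} (hq : ‖q‖ < 1) :
    Tendsto (qFactorial a q) atTop (𝓝 (qFactorialInf a q)) :=
  (multipliable_qFactorialInf a hq).hasProd.tendsto_prod_nat

theorem qFactorialInf_self_ne_zero {q : ℂ} (hq : ‖q‖ < 1) : qFactorialInf q q ≠ 0 := by
  have h : Summable fun j : ℕ => ‖-(q * q ^ j)‖ := by
    simpa [norm_mul, norm_pow] using
      (summable_geometric_of_lt_one (norm_nonneg q) hq).mul_left ‖q‖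
  have h1 := tprod_one_add_ne_zero_of_summable (f := fun j : ℕ => -(q * q ^ j)) (fun j => by
    rw [← sub_eq_add_neg, ← pow_succ']
    exact one_sub_pow_ne_zero hq j) h
  simpa [qFactorialInf, sub_eq_add_neg] using h1

theorem exists_bound_qFactorial {q : ℂ} (hq : ‖q‖ < 1) :
    ∃ B : ℝ, 0 ≤ B ∧ ∀ m, ‖qFactorial q q m‖ ≤ B ∧ ‖(qFactorial q q m)⁻¹‖ ≤ B := by
  have h1 := tendsto_qFactorial q hq
  obtain ⟨B₁, hB₁⟩ := h1.norm.bddAbove_range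
  obtain ⟨B₂, hB₂⟩ := (h1.inv₀ (qFactorialInf_self_ne_zero hq)).norm.bddAbove_range
  have h2 : ∀ m, ‖qFactorial q q m‖ ≤ B₁ := fun m => hB₁ ⟨m, rfl⟩
  have h3 : ∀ m, ‖(qFactorial q q m)⁻¹‖ ≤ B₂ := fun m => hB₂ ⟨m, rfl⟩
  exact ⟨max B₁ B₂, (norm_nonneg _).trans ((h2 0).trans (le_max_left _ _)), fun m =>
    ⟨(h2 m).trans (le_max_left _ _), (h3 m).trans (le_max_right _ _)⟩⟩

/-! ### The Jacobi triple product. -/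

/-- The general term of the bilateral series in the Jacobi triple product identity. -/
noncomputable def tripleTerm (z w p : ℂ) : ℤ → ℂ
  | Int.ofNat j => (-1) ^ j * p ^ j.choose 2 * z ^ j
  | Int.negSucc j => (-1) ^ (j + 1) * p ^ (j + 1).choose 2 * w ^ (j + 1)

theorem tripleTerm_natCast (z w p : ℂ) (j : ℕ) :
    tripleTerm z w p j = (-1) ^ j * p ^ j.choose 2 * z ^ j := rfl

theorem tripleTerm_negSucc (z w p : ℂ) (j : ℕ) :
    tripleTerm z w p (Int.negSucc j) = (-1) ^ (j + 1) * p ^ (j + 1).choose 2 * w ^ (j + 1) := rfl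

theorem tripleTerm_neg (z w p : ℂ) (j : ℤ) : tripleTerm z w p (-j) = tripleTerm w z p j := by
  rcases j with (_ | j) | j
  · simp [tripleTerm]
  · exact tripleTerm_negSucc z w p j
  · exact tripleTerm_natCast z w p (j + 1)

/-- Under zw = p the general term is (-1)^j p^{j(j-1)/2} z^j for all integers j; using w for
negative j avoids dividing by z. This is the ratio of consecutive terms, cleared of negative powers
of p. -/
theorem tripleTerm_add_one {z w p : ℂ} (hzw : z * w = p) (j : ℤ) (i n : ℕ) (h : j + i = n) :
    z * p ^ n * tripleTerm z w p j = -(p ^ i * tripleTerm z w p (j + 1)) := by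
  rcases j with j | (_ | j)
  · have h' : (j : ℤ) + i = n := h
    obtain rfl : j + i = n := by exact_mod_cast h'
    rw [show Int.ofNat j + 1 = ((j + 1 : ℕ) : ℤ) by simp, tripleTerm_natCast, Int.ofNat_eq_natCast,
      tripleTerm_natCast, choose_two_succ]
    ring
  · obtain rfl : i = n + 1 := by omega
    rw [show Int.negSucc 0 + 1 = ((0 : ℕ) : ℤ) by simp, tripleTerm_natCast, tripleTerm_negSucc]
    simp
    rw [pow_succ, ← hzw]
    ring
  · obtain rfl : i = n + j + 2 := by omega
    rw [show Int.negSucc (j + 1) + 1 = Int.negSucc j by omega, tripleTerm_negSucc,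
      tripleTerm_negSucc, choose_two_succ (j + 1)]
    have e : p ^ (n + j + 2) = p ^ n * p ^ (j + 1) * (z * w) := by rw [hzw]; ring
    rw [e]
    ring

theorem sum_qBinomial_succ {p : ℂ} (hp : ‖p‖ < 1) (x : ℂ) (u : ℕ → ℂ) (L : ℕ)
    (hu : ∀ k ≤ L, x * u k = -(p ^ (L - k) * u (k + 1))) :
    (1 - p ^ (L + 1)) * ∑ k ∈ range (L + 1 + 1), u k /
        (qFactorial p p (L + 1 - k) * qFactorial p p k) =
      (1 - x) * ∑ k ∈ range (L + 1), u k / (qFactorial p p (L - k) * qFactorial p p k) := by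
  have hne := qFactorial_self_ne_zero hp
  have hone := one_sub_pow_ne_zero hp
  -- The q-Pascal splitting 1 - p^{L+1} = (1 - p^{L+1-k}) + p^{L+1-k}(1 - p^k). Each half cancels a
  -- denominator factor and loses one end term; after an index shift `hu` recombines them.
  have h1 : ∀ k ∈ range (L + 1 + 1), (1 - p ^ (L + 1)) * (u k /
        (qFactorial p p (L + 1 - k) * qFactorial p p k)) =
      (1 - p ^ (L + 1 - k)) * u k / (qFactorial p p (L + 1 - k) * qFactorial p p k) +
      p ^ (L + 1 - k) * (1 - p ^ k) * u k / (qFactorial p p (L + 1 - k) * qFactorial p p k) := by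
    intro k hk
    have hk' : k ≤ L + 1 := by simpa [Nat.lt_succ_iff] using hk
    have e : p ^ (L + 1) = p ^ (L + 1 - k) * p ^ k := by
      rw [← pow_add, Nat.sub_add_cancel hk']
    rw [e]
    ring
  rw [mul_sum, sum_congr rfl h1, sum_add_distrib, sum_range_succ, sum_range_succ' _ (L + 1)]
  simp only [Nat.sub_self, pow_zero, sub_self, zero_mul, mul_zero, zero_div, add_zero]
  rw [← sum_add_distrib, mul_sum]
  refine sum_congr rfl fun k hk => ?_
  have hk' : k ≤ L := by simpa [Nat.lt_succ_iff] using hk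
  have hu' := hu k hk'
  obtain ⟨i, rfl⟩ := Nat.exists_eq_add_of_le' hk'
  rw [Nat.add_sub_cancel] at hu'
  rw [show i + k + 1 - k = i + 1 by omega, show i + k + 1 - (k + 1) = i by omega,
    Nat.add_sub_cancel, qFactorial_self_succ, qFactorial_self_succ, sub_mul 1 x, ← mul_div_assoc x,
    hu']
  have h2 := hne i
  have h3 := hne k
  have h4 := hone i
  have h5 := hone k
  field_simp
  ring

theorem sum_tripleTerm_symm (z w p : ℂ) (n m : ℕ) :
    ∑ k ∈ range (n + m + 1), tripleTerm z w p ((k : ℤ) - m) /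
        (qFactorial p p (n + m - k) * qFactorial p p k) =
      ∑ k ∈ range (m + n + 1), tripleTerm w z p ((k : ℤ) - n) /
        (qFactorial p p (m + n - k) * qFactorial p p k) := by
  rw [← sum_range_reflect, add_comm m n]
  refine sum_congr rfl fun k hk => ?_
  have hk' : k ≤ n + m := by simpa [Nat.lt_succ_iff] using hk
  rw [show n + m + 1 - 1 - k = n + m - k by omega, show n + m - (n + m - k) = k by omega,
    ← tripleTerm_neg z w, show ((n + m - k : ℕ) : ℤ) - m = -((k : ℤ) - n) by omega,
    mul_comm (qFactorial p p k)]

theorem sum_tripleTerm_succ {z w p : ℂ} (hp : ‖p‖ < 1) (hzw : z * w = p) (n m : ℕ) :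
    (1 - p ^ (n + m + 1)) * ∑ k ∈ range (n + m + 1 + 1), tripleTerm z w p ((k : ℤ) - m) /
        (qFactorial p p (n + m + 1 - k) * qFactorial p p k) =
      (1 - z * p ^ n) * ∑ k ∈ range (n + m + 1), tripleTerm z w p ((k : ℤ) - m) /
        (qFactorial p p (n + m - k) * qFactorial p p k) := by
  refine sum_qBinomial_succ hp (z * p ^ n) (fun k => tripleTerm z w p ((k : ℤ) - m)) (n + m)
    fun k hk => ?_
  rw [tripleTerm_add_one hzw _ (n + m - k) n (by omega)]
  congr 3
  push_cast
  ring

/-- The finite form of the Jacobi triple product identity. -/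
theorem sum_tripleTerm {z w p : ℂ} (hp : ‖p‖ < 1) (hzw : z * w = p) (n m : ℕ) :
    ∑ k ∈ range (n + m + 1), tripleTerm z w p ((k : ℤ) - m) /
        (qFactorial p p (n + m - k) * qFactorial p p k) =
      qFactorial z p n * qFactorial w p m / qFactorial p p (n + m) := by
  have hne := qFactorial_self_ne_zero hp
  have hone := one_sub_pow_ne_zero hp
  have step : ∀ {z w : ℂ} (_ : z * w = p) (m : ℕ) (y : ℂ),
      (∑ k ∈ range (0 + m + 1), tripleTerm z w p ((k : ℤ) - m) /
        (qFactorial p p (0 + m - k) * qFactorial p p k) = y / qFactorial p p m) → ∀ n,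
      ∑ k ∈ range (n + m + 1), tripleTerm z w p ((k : ℤ) - m) /
        (qFactorial p p (n + m - k) * qFactorial p p k) =
      qFactorial z p n * y / qFactorial p p (n + m) := by
    intro z w hzw m y h0 n
    induction n with
    | zero => rw [h0]; simp [qFactorial]
    | succ n ih =>
      have h := sum_tripleTerm_succ hp hzw n m
      rw [ih] at h
      rw [show n + 1 + m = n + m + 1 by ring]
      apply mul_left_cancel₀ (hone (n + m))
      rw [h, qFactorial_succ, qFactorial_self_succ]
      have h2 := hne (n + m)
      have h3 := hone (n + m)
      field_simp
  -- Induct on n; the base case n = 0 is reflected, exchanging z and w, and becomes the same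
  -- induction on m.
  refine step hzw m _ ?_ n
  rw [sum_tripleTerm_symm, step (mul_comm z w ▸ hzw) 0 1 (by simp [tripleTerm, qFactorial]) m,
    mul_one, add_zero]

theorem summable_norm_tripleTerm {z w p : ℂ} (hp : ‖p‖ < 1) (hz : ‖z‖ < 1) (hw : ‖w‖ < 1) :
    Summable fun j => ‖tripleTerm z w p j‖ := by
  have hb : ∀ {z : ℂ} (_ : ‖z‖ < 1) (j : ℕ), ‖(-1) ^ j * p ^ j.choose 2 * z ^ j‖ ≤ ‖z‖ ^ j := by
    intro z _ j
    rw [norm_mul, norm_mul, norm_pow, norm_pow, norm_pow, norm_neg, norm_one, one_pow, one_mul]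
    exact mul_le_of_le_one_left (by positivity) (pow_le_one₀ (norm_nonneg _) hp.le)
  refine Summable.of_nat_of_neg ?_ ?_
  · exact Summable.of_nonneg_of_le (fun _ => norm_nonneg _) (fun j => hb hz j)
      (summable_geometric_of_lt_one (norm_nonneg z) hz)
  · refine Summable.of_nonneg_of_le (fun _ => norm_nonneg _) (fun j => ?_)
      (summable_geometric_of_lt_one (norm_nonneg w) hw)
    rw [tripleTerm_neg]
    exact hb hw j

/-- The Jacobi triple product identity. -/
theorem hasSum_tripleTerm {z w p : ℂ} (hp : ‖p‖ < 1) (hz : ‖z‖ < 1) (hw : ‖w‖ < 1)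
    (hzw : z * w = p) :
    HasSum (tripleTerm z w p) (qFactorialInf₃ z w p p) := by
  have hne := qFactorialInf_self_ne_zero hp
  obtain ⟨B, hB0, hB⟩ := exists_bound_qFactorial hp
  have hs := summable_norm_tripleTerm hp hz hw
  have hlim := tendsto_qFactorial p hp
  -- The finite identity with n = m, recentred at j = k - n and extended by zero, so that dominated
  -- convergence over ℤ applies.
  let f : ℕ → ℤ → ℂ := fun n j => if j.natAbs ≤ n then tripleTerm z w p j *
    ((qFactorial p p (n - j).toNat)⁻¹ * (qFactorial p p (n + j).toNat)⁻¹) else 0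
  have hf : ∀ n, ∑' j, f n j =
      qFactorial z p n * qFactorial w p n / qFactorial p p (n + n) := by
    intro n
    rw [← sum_tripleTerm hp hzw n n]
    have hinj : Set.InjOn (fun k : ℕ => (k : ℤ) - n) (range (n + n + 1)) := by
      intro a _ b _ hab
      simpa using hab
    rw [tsum_eq_sum (s := (range (n + n + 1)).image fun k : ℕ => (k : ℤ) - n), sum_image hinj]
    · refine sum_congr rfl fun k hk => ?_
      rw [mem_range] at hk
      simp only [f]
      rw [if_pos (by omega), show ((n : ℤ) - (k - n)).toNat = n + n - k by omega,
        show ((n : ℤ) + (k - n)).toNat = k by omega, ← mul_inv, div_eq_mul_inv]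
    · intro j hj
      simp only [f]
      refine if_neg fun h => hj ?_
      rw [mem_image]
      exact ⟨(j + n).toNat, by rw [mem_range]; omega, by omega⟩
  have ht := tendsto_tsum_of_dominated_convergence (𝓕 := atTop) (f := f)
    (g := fun j => tripleTerm z w p j * ((qFactorialInf p p)⁻¹ * (qFactorialInf p p)⁻¹))
    (bound := fun j => ‖tripleTerm z w p j‖ * (B * B)) (hs.mul_right _)
    (by
      intro j
      have h1 : Tendsto (fun n : ℕ => ((n : ℤ) - j).toNat) atTop atTop :=
        tendsto_atTop_mono (f := fun n : ℕ => n - j.natAbs) (fun n => by omega)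
          (tendsto_sub_atTop_nat _)
      have h2 : Tendsto (fun n : ℕ => ((n : ℤ) + j).toNat) atTop atTop :=
        tendsto_atTop_mono (f := fun n : ℕ => n - j.natAbs) (fun n => by omega)
          (tendsto_sub_atTop_nat _)
      refine Tendsto.congr' ?_ (tendsto_const_nhds.mul
        (((hlim.comp h1).inv₀ hne).mul ((hlim.comp h2).inv₀ hne)))
      filter_upwards [eventually_ge_atTop j.natAbs] with n hn
      simp only [f, if_pos hn, Function.comp])
    (by
      refine Eventually.of_forall fun n j => ?_
      simp only [f]
      split_ifs
      · rw [norm_mul, norm_mul]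
        gcongr
        · exact (hB _).2
        · exact (hB _).2
      · rw [norm_zero]; positivity)
  simp only [hf] at ht
  have ht' : Tendsto (fun n => qFactorial z p n * qFactorial w p n / qFactorial p p (n + n)) atTop
      (𝓝 (qFactorialInf z p * qFactorialInf w p / qFactorialInf p p)) :=
    ((tendsto_qFactorial z hp).mul (tendsto_qFactorial w hp)).div
      (hlim.comp (tendsto_atTop_mono (fun n => Nat.le_add_left n n) tendsto_id)) hne
  have heq := tendsto_nhds_unique ht ht'
  rw [tsum_mul_right] at heq
  have hfin : ∑' j, tripleTerm z w p j = qFactorialInf₃ z w p p := by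
    rw [qFactorialInf₃]
    field_simp at heq
    rw [heq]
    ring
  exact hfin ▸ hs.of_norm.hasSum

/-! ### The limiting Bailey step and the double series. -/

/-- The limiting case of `sum_bailey_kernel`. -/
theorem hasSum_bailey_kernel {q : ℂ} (hq : ‖q‖ < 1) (c : ℕ) :
    HasSum (fun s => q ^ (s ^ 2 + c * s) / (qFactorial q q s * qFactorial q q (s + c)))
      (1 / qFactorialInf q q) := by
  have hne := qFactorialInf_self_ne_zero hq
  obtain ⟨B, hB0, hB⟩ := exists_bound_qFactorial hq
  have hlim := tendsto_qFactorial q hq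
  have hgeo := summable_geometric_of_lt_one (norm_nonneg q) hq
  have hterm : ∀ s, ‖q ^ (s ^ 2 + c * s) / (qFactorial q q s * qFactorial q q (s + c))‖ ≤
      ‖q‖ ^ s * (B * B) := by
    intro s
    rw [div_eq_mul_inv, mul_inv, norm_mul, norm_mul, norm_pow]
    refine mul_le_mul (pow_le_pow_of_le_one (norm_nonneg _) hq.le (by nlinarith)) ?_
      (by positivity) (by positivity)
    gcongr
    · exact (hB _).2
    · exact (hB _).2
  have hsum : Summable fun s => q ^ (s ^ 2 + c * s) /
      (qFactorial q q s * qFactorial q q (s + c)) :=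
    Summable.of_norm_bounded (hgeo.mul_right _) hterm
  let f : ℕ → ℕ → ℂ := fun M s => if s ≤ M then q ^ (s ^ 2 + c * s) /
    (qFactorial q q s * qFactorial q q (s + c)) * (qFactorial q q (M - s))⁻¹ else 0
  have hf : ∀ M, ∑' s, f M s = 1 / (qFactorial q q M * qFactorial q q (M + c)) := by
    intro M
    rw [← sum_bailey_kernel hq M c, tsum_eq_sum (s := range (M + 1))]
    · refine sum_congr rfl fun s hs => ?_
      simp only [f]
      rw [if_pos (by simpa [Nat.lt_succ_iff] using hs)]
      ring
    · intro s hs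
      simp only [f]
      exact if_neg (by simpa using hs)
  have ht := tendsto_tsum_of_dominated_convergence (𝓕 := atTop) (f := f)
    (g := fun s => q ^ (s ^ 2 + c * s) / (qFactorial q q s * qFactorial q q (s + c)) *
      (qFactorialInf q q)⁻¹)
    (bound := fun s => ‖q‖ ^ s * (B * B) * B) ((hgeo.mul_right _).mul_right _)
    (by
      intro s
      refine Tendsto.congr' ?_ (tendsto_const_nhds.mul
        ((hlim.comp (tendsto_sub_atTop_nat s)).inv₀ hne))
      filter_upwards [eventually_ge_atTop s] with n hn
      simp only [f, if_pos hn, Function.comp])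
    (by
      refine Eventually.of_forall fun n s => ?_
      simp only [f]
      split_ifs
      · rw [norm_mul]
        exact mul_le_mul (hterm s) (hB _).2 (norm_nonneg _) (by positivity)
      · rw [norm_zero]; positivity)
  simp only [hf] at ht
  have ht' : Tendsto (fun M => 1 / (qFactorial q q M * qFactorial q q (M + c))) atTop
      (𝓝 (1 / (qFactorialInf q q * qFactorialInf q q))) :=
    tendsto_const_nhds.div (hlim.mul (hlim.comp (tendsto_add_atTop_nat c))) (mul_ne_zero hne hne)
  have heq := tendsto_nhds_unique ht ht'
  rw [tsum_mul_right] at heq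
  have hfin : ∑' s, q ^ (s ^ 2 + c * s) / (qFactorial q q s * qFactorial q q (s + c)) =
      1 / qFactorialInf q q := by
    apply mul_right_cancel₀ (inv_ne_zero hne)
    rw [heq]
    field_simp
  exact hfin ▸ hsum.hasSum

theorem hasSum_antidiagonal {F : ℕ × ℕ → ℂ} {a : ℂ} (h : HasSum F a) :
    HasSum (fun N => ∑ p ∈ antidiagonal N, F p) a := by
  have h1 := (HasAntidiagonal.sigmaAntidiagonalEquivProd (A := ℕ)).hasSum_iff.2 h
  refine h1.sigma fun N => ?_
  have h2 := hasSum_fintype fun c : antidiagonal N => F c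
  rwa [sum_coe_sort (antidiagonal N) F] at h2

/-- Regrouping by N: the families in (n, r) and in (j, N - j) differ termwise and agree only after
summation over each antidiagonal. -/
theorem hasSum_of_antidiagonal_eq {F G : ℕ × ℕ → ℂ} {a : ℂ} (hF : Summable F) (hG : HasSum G a)
    (h : ∀ N, ∑ p ∈ antidiagonal N, F p = ∑ p ∈ antidiagonal N, G p) : HasSum F a := by
  have h1 := hasSum_antidiagonal hF.hasSum
  have h2 := hasSum_antidiagonal hG
  simp only [← h] at h2
  exact h1.unique h2 ▸ hF.hasSum

theorem summable_of_norm_le_geometric {F : ℕ × ℕ → ℂ} {x K : ℝ} (hx0 : 0 ≤ x) (hx : x < 1)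
    (h : ∀ p, ‖F p‖ ≤ x ^ p.1 * x ^ p.2 * K) : Summable F := by
  have hgeo := summable_geometric_of_lt_one hx0 hx
  exact Summable.of_norm_bounded
    ((hgeo.mul_of_nonneg hgeo (fun _ => by positivity) (fun _ => by positivity)).mul_right K) h

theorem le_three_mul_sq_add (a c b : ℕ) : a ≤ 3 * (a ^ 2 + c * a) + b := by
  have h : a ≤ a ^ 2 := Nat.le_self_pow two_ne_zero a
  omega

/-- The summand of the double series; `c = 0` and `c = 1` are the two cases of interest. -/
noncomputable def doubleTerm (q : ℂ) (c : ℕ) (p : ℕ × ℕ) : ℂ :=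
  q ^ (3 * ((p.1 + p.2) ^ 2 + c * (p.1 + p.2)) + (p.2 ^ 2 + c * p.2)) *
    (qFactorial q q (p.1 + p.2) * qFactorial q q (2 * (p.1 + p.2) + p.2 + c) *
      qFactorial q q (p.1 + p.2 + p.2 + c) *
    ((qFactorial (q ^ 3) (q ^ 3) (p.1 + p.2))⁻¹ *
      (qFactorial (q ^ 3) (q ^ 3) (p.1 + p.2 + p.2 + c))⁻¹ * (qFactorial q q p.1)⁻¹ *
      (qFactorial q q p.2)⁻¹ * (qFactorial q q (2 * (p.1 + p.2) + c))⁻¹))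

theorem summable_doubleTerm {q : ℂ} (hq : ‖q‖ < 1) (c : ℕ) : Summable (doubleTerm q c) := by
  obtain ⟨B, hB0, hB⟩ := exists_bound_qFactorial hq
  obtain ⟨B', hB0', hB'⟩ := exists_bound_qFactorial (norm_cube_lt_one hq)
  refine summable_of_norm_le_geometric (K := B * B * B * (B' * B' * B * B * B)) (norm_nonneg q) hq
    fun p => ?_
  rw [doubleTerm]
  simp only [norm_mul, norm_pow q]
  rw [← pow_add]
  refine mul_le_mul (pow_le_pow_of_le_one (norm_nonneg _) hq.le (le_three_mul_sq_add _ _ _)) ?_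
    (by positivity) (by positivity)
  gcongr
  · exact (hB _).1
  · exact (hB _).1
  · exact (hB _).1
  · exact (hB' _).2
  · exact (hB' _).2
  · exact (hB _).2
  · exact (hB _).2
  · exact (hB _).2

theorem sum_antidiagonal_doubleTerm (q : ℂ) (c N : ℕ) :
    ∑ p ∈ antidiagonal N, doubleTerm q c p = q ^ (3 * (N ^ 2 + c * N)) *
      ∑ r ∈ range (N + 1), q ^ (r ^ 2 + c * r) * qFactorial q q N * qFactorial q q (2 * N + r + c) *
        qFactorial q q (N + r + c) / (qFactorial (q ^ 3) (q ^ 3) N *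
        qFactorial (q ^ 3) (q ^ 3) (N + r + c) * qFactorial q q (N - r) * qFactorial q q r *
        qFactorial q q (2 * N + c)) := by
  rw [← Nat.sum_antidiagonal_swap, Nat.sum_antidiagonal_eq_sum_range_succ_mk, mul_sum]
  refine sum_congr rfl fun r hr => ?_
  have hr' : r ≤ N := by simpa [Nat.lt_succ_iff] using hr
  simp only [doubleTerm, Prod.fst_swap, Prod.snd_swap, Nat.sub_add_cancel hr', pow_add q (3 * _),
    div_eq_mul_inv, mul_inv]
  ring

/-- The double series as a single theta series, for a unit Bailey pair relative to `q ^ c`. -/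
theorem hasSum_doubleTerm {q : ℂ} (hq : ‖q‖ < 1) {c : ℕ} {α : ℕ → ℂ} (hα : IsUnitBailey q c α)
    {b : ℝ} (hb : ∀ j, ‖α j‖ ≤ b) {t : ℂ}
    (ht : HasSum (fun j => q ^ (5 * (j ^ 2 + c * j)) * α j) t) :
    HasSum (doubleTerm q c) (t / qFactorialInf (q ^ 3) (q ^ 3)) := by
  have hq3 := norm_cube_lt_one hq
  obtain ⟨B, hB0, hB⟩ := exists_bound_qFactorial hq3
  have hb0 : 0 ≤ b := (norm_nonneg _).trans (hb 0)
  -- Indexed by (j, M) with N = j + M. Antidiagonals recover the inner sums; rows with j fixed are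
  -- limiting kernels in base q³ with shift 2j + c.
  let H : ℕ × ℕ → ℂ := fun p => q ^ (3 * ((p.1 + p.2) ^ 2 + c * (p.1 + p.2)) +
    2 * (p.1 ^ 2 + c * p.1)) * (α p.1 * ((qFactorial (q ^ 3) (q ^ 3) p.2)⁻¹ *
      (qFactorial (q ^ 3) (q ^ 3) (p.1 + p.2 + p.1 + c))⁻¹))
  have hH : Summable H := by
    refine summable_of_norm_le_geometric (K := b * (B * B)) (norm_nonneg q) hq fun p => ?_
    simp only [H, norm_mul, norm_pow q]
    rw [← pow_add]
    refine mul_le_mul (pow_le_pow_of_le_one (norm_nonneg _) hq.le (le_three_mul_sq_add _ _ _)) ?_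
      (by positivity) (by positivity)
    gcongr
    · exact hb _
    · exact (hB _).2
    · exact (hB _).2
  have hfib : ∀ j, HasSum (fun M => H (j, M))
      (q ^ (5 * (j ^ 2 + c * j)) * α j * (1 / qFactorialInf (q ^ 3) (q ^ 3))) := by
    intro j
    refine ((hasSum_bailey_kernel hq3 (2 * j + c)).mul_left _).congr_fun ?_
    intro M
    simp only [H]
    rw [← pow_mul, show j + M + j + c = M + (2 * j + c) by ring, div_eq_mul_inv, mul_inv]
    ring
  have hHsum : HasSum H (t / qFactorialInf (q ^ 3) (q ^ 3)) := by
    have h1 := hH.hasSum.prod_fiberwise hfib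
    rw [div_eq_mul_one_div, ← h1.unique (ht.mul_right _)]
    exact hH.hasSum
  refine hasSum_of_antidiagonal_eq (summable_doubleTerm hq c) hHsum fun N => ?_
  rw [sum_antidiagonal_doubleTerm, hα.sum_inner hq, Nat.sum_antidiagonal_eq_sum_range_succ_mk,
    mul_sum]
  refine sum_congr rfl fun j hj => ?_
  have hj' : j ≤ N := by simpa [Nat.lt_succ_iff] using hj
  simp only [H, Nat.add_sub_cancel' hj', pow_add q (3 * _), div_eq_mul_inv, mul_inv]
  ring

/-! ### Theta series in base q¹¹. -/

theorem two_mul_choose_two_add (j : ℕ) : 2 * j.choose 2 + j = j ^ 2 := by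
  induction j with
  | zero => rfl
  | succ j ih => rw [choose_two_succ]; linarith

theorem hasSum_unitAlphaOne {q : ℂ} (hq : ‖q‖ < 1) :
    HasSum (fun j => q ^ (5 * (j ^ 2 + 0 * j)) * unitAlphaOne q j)
      (qFactorialInf₃ (q ^ 5) (q ^ 6) (q ^ 11) (q ^ 11)) := by
  have hp (n : ℕ) : ‖q ^ (n + 1)‖ < 1 := by
    rw [norm_pow]
    exact pow_lt_one₀ (norm_nonneg _) hq (by simp)
  have h := (hasSum_tripleTerm (hp 10) (hp 4) (hp 5) (by ring)).nat_add_neg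
  -- Folding j with -j counts the index 0 twice; one copy is removed, in accordance with α_0 = 1.
  have h1 := h.sub (hasSum_ite_eq (0 : ℕ) (1 : ℂ))
  have h0 : tripleTerm (q ^ 5) (q ^ 6) (q ^ 11) 0 = 1 := by simp [tripleTerm]
  simp only [Nat.reduceAdd] at h1
  rw [h0, add_sub_cancel_right] at h1
  refine h1.congr_fun fun j => ?_
  rw [tripleTerm_neg, tripleTerm_natCast, tripleTerm_natCast, unitAlphaOne]
  split_ifs with hj
  · subst hj
    norm_num
  · rw [← two_mul_choose_two_add]
    ring

/-- Fold j with -(j + 1): the two parts of 1 - q^{2j+1} give exponents 11·C(j,2) + 10j and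
11·C(j+1,2) + (j + 1). -/
theorem hasSum_unitAlphaBase {q : ℂ} (hq : ‖q‖ < 1) :
    HasSum (fun j => q ^ (5 * (j ^ 2 + 1 * j)) * unitAlphaBase q j)
      (qFactorialInf₃ q (q ^ 10) (q ^ 11) (q ^ 11)) := by
  have hp (n : ℕ) : ‖q ^ (n + 1)‖ < 1 := by
    rw [norm_pow]
    exact pow_lt_one₀ (norm_nonneg _) hq (by simp)
  have h := (hasSum_tripleTerm (hp 10) (hp 9) hq (by ring)).nat_add_neg_add_one
  have e : qFactorialInf₃ (q ^ 10) q (q ^ 11) (q ^ 11) =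
      qFactorialInf₃ q (q ^ 10) (q ^ 11) (q ^ 11) := by
    simp only [qFactorialInf₃, mul_comm (qFactorialInf q _)]
  simp only [Nat.reduceAdd] at h
  rw [e] at h
  refine h.congr_fun fun j => ?_
  rw [show (-((j : ℤ) + 1)) = Int.negSucc j by omega, tripleTerm_natCast, tripleTerm_negSucc,
    unitAlphaBase, choose_two_succ, ← two_mul_choose_two_add]
  ring

theorem mainTheorem11 (q : ℂ) (hq : ‖q‖ < 1) :
    HasSum
      (fun p : ℕ × ℕ =>
        let n := p.1
        let r := p.2
        q ^ (3 * n ^ 2 + 6 * n * r + 4 * r ^ 2) *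
            qFactorial q q (n + r) * qFactorial q q (2 * n + 3 * r) *
            qFactorial q q (n + 2 * r) /
          (qFactorial (q ^ 3) (q ^ 3) (n + r) * qFactorial (q ^ 3) (q ^ 3) (n + 2 * r) *
            qFactorial q q n * qFactorial q q r * qFactorial q q (2 * n + 2 * r)))
      (qFactorialInf₃ (q ^ 5) (q ^ 6) (q ^ 11) (q ^ 11) / qFactorialInf (q ^ 3) (q ^ 3)) ∧
    HasSum
      (fun p : ℕ × ℕ =>
        let n := p.1
        let r := p.2
        q ^ (3 * n ^ 2 + 6 * n * r + 4 * r ^ 2 + 3 * n + 4 * r) *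
            qFactorial q q (n + r) * qFactorial q q (2 * n + 3 * r + 1) *
            qFactorial q q (n + 2 * r + 1) /
          (qFactorial (q ^ 3) (q ^ 3) (n + r) * qFactorial (q ^ 3) (q ^ 3) (n + 2 * r + 1) *
            qFactorial q q n * qFactorial q q r * qFactorial q q (2 * n + 2 * r + 1)))
      (qFactorialInf₃ q (q ^ 10) (q ^ 11) (q ^ 11) / qFactorialInf (q ^ 3) (q ^ 3)) := by
  constructor
  · refine (hasSum_doubleTerm hq (isUnitBailey_unitAlphaOne hq) (norm_unitAlphaOne_le hq)
      (hasSum_unitAlphaOne hq)).congr_fun ?_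
    rintro ⟨n, r⟩
    simp only [doubleTerm, div_eq_mul_inv, mul_inv]
    rw [show 3 * ((n + r) ^ 2 + 0 * (n + r)) + (r ^ 2 + 0 * r) =
        3 * n ^ 2 + 6 * n * r + 4 * r ^ 2 by ring,
      show 2 * (n + r) + r + 0 = 2 * n + 3 * r by ring,
      show n + r + r + 0 = n + 2 * r by ring, show 2 * (n + r) + 0 = 2 * n + 2 * r by ring]
    ring
  · refine (hasSum_doubleTerm hq (isUnitBailey_unitAlphaBase hq) (norm_unitAlphaBase_le hq)
      (hasSum_unitAlphaBase hq)).congr_fun ?_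
    rintro ⟨n, r⟩
    simp only [doubleTerm, div_eq_mul_inv, mul_inv]
    rw [show 3 * ((n + r) ^ 2 + 1 * (n + r)) + (r ^ 2 + 1 * r) =
        3 * n ^ 2 + 6 * n * r + 4 * r ^ 2 + 3 * n + 4 * r by ring,
      show 2 * (n + r) + r + 1 = 2 * n + 3 * r + 1 by ring,
      show n + r + r + 1 = n + 2 * r + 1 by ring,
      show 2 * (n + r) + 1 = 2 * n + 2 * r + 1 by ring]
    ring
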